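/- For elements $x,y$ of a complex normed space $X$, write $x\perp_{BJ}y$ (Birkhoff--James orthogonality) if $\|x+\alpha y\|\ge\|x\|$ for all $\alpha\in\mathbb C$. For $C^*$-algebras $A,B$, the minimal norm of $u\in A\otimes B$ (algebraic tensor product) is $\|u\|_{\min}=\sup\|(\pi_1\otimes\pi_2)(u)\|$, the supremum being over all $*$-representations $\pi_1:A\to B(K)$ and $\pi_2:B\to B(L)$ on Hilbert spaces $K,L$, where $\pi_1\otimes\pi_2:A\otimes B\to B(K\bar\otimes L)$ is the linear map determined by $a\otimes b\mapsto\pi_1(a)\otimes\pi_2(b)$ and $K\bar\otimes L$ is the Hilbert space tensor product; $A\otimes^{\min}B$ is the completion of $A\otimes B$ in this norm. **Proposition.** Let $H$ be a complex Hilbert space, let $B(H)$ be the $C^*$-algebra of bounded linear operators on $H$ with the operator norm, and let $T_1,T_2,S_1,S_2\in B(H)$ be rank one operators (operators with one-dimensional range) such that $T_1\otimes T_2\perp_{BJ}S_1\otimes S_2$ in $B(H)\otimes^{\min}B(H)$. Then $T_1\perp_{BJ}S_1$ in $B(H)$ or $T_2\perp_{BJ}S_2$ in $B(H)$. -/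

import Mathlib

open scoped TensorProduct

noncomputable section

universe u v w z

/-- Birkhoff-James orthogonality in a normed space over `𝕜`:
`‖x‖ ≤ ‖x + α y‖` for every scalar `α`. -/
def BJOrthogonal (𝕜 : Type*) {X : Type*} [NormedField 𝕜] [SeminormedAddCommGroup X]
    [NormedSpace 𝕜 X] (x y : X) : Prop :=
  ∀ α : 𝕜, ‖x‖ ≤ ‖x + α • y‖

/-- A bounded operator has rank one if its range is one-dimensional. -/
def IsRankOneOp {H : Type*} [NormedAddCommGroup H] [InnerProductSpace ℂ H]
    (T : H →L[ℂ] H) : Prop :=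
  Module.finrank ℂ (LinearMap.range (T : H →ₗ[ℂ] H)) = 1

section HilbertTensor

variable (K : Type u) (L : Type v)
  [NormedAddCommGroup K] [InnerProductSpace ℂ K]
  [NormedAddCommGroup L] [InnerProductSpace ℂ L]

/-- The Hilbert space tensor product: the completion of the algebraic tensor product for the
inner product determined by `⟪x ⊗ y, x' ⊗ y'⟫ = ⟪x, x'⟫ ⟪y, y'⟫`. -/
def HilbertTensor : Type (max u v) :=
  UniformSpace.Completion (K ⊗[ℂ] L)

instance : NormedAddCommGroup (HilbertTensor K L) :=
  inferInstanceAs (NormedAddCommGroup (UniformSpace.Completion (K ⊗[ℂ] L)))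

instance : InnerProductSpace ℂ (HilbertTensor K L) :=
  inferInstanceAs (InnerProductSpace ℂ (UniformSpace.Completion (K ⊗[ℂ] L)))

instance : CompleteSpace (HilbertTensor K L) :=
  inferInstanceAs (CompleteSpace (UniformSpace.Completion (K ⊗[ℂ] L)))

variable {K L}

/-- The isometric inclusion of the algebraic tensor product into the Hilbert space tensor
product. -/
def toHilbertTensor : K ⊗[ℂ] L →ₗᵢ[ℂ] HilbertTensor K L :=
  (UniformSpace.Completion.toComplₗᵢ :
    K ⊗[ℂ] L →ₗᵢ[ℂ] UniformSpace.Completion (K ⊗[ℂ] L))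

theorem denseRange_toHilbertTensor :
    DenseRange (toHilbertTensor : K ⊗[ℂ] L → HilbertTensor K L) :=
  UniformSpace.Completion.denseRange_coe

/-- The tensor product of two bounded operators, acting on the Hilbert space tensor product; it is
the bounded extension of `x ⊗ y ↦ f x ⊗ g y`. -/
def opTensor (f : K →L[ℂ] K) (g : L →L[ℂ] L) : HilbertTensor K L →L[ℂ] HilbertTensor K L :=
  (TensorProduct.mapL f g).completion

theorem opTensor_coe (f : K →L[ℂ] K) (g : L →L[ℂ] L) (x : K ⊗[ℂ] L) :
    opTensor f g (toHilbertTensor x) = toHilbertTensor (TensorProduct.mapL f g x) :=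
  ContinuousLinearMap.completion_apply_coe _ _

theorem opTensor_ext {F G : HilbertTensor K L →L[ℂ] HilbertTensor K L}
    (h : ∀ x : K ⊗[ℂ] L, F (toHilbertTensor x) = G (toHilbertTensor x)) : F = G :=
  DFunLike.coe_injective
    (denseRange_toHilbertTensor.equalizer F.continuous G.continuous (funext h))

theorem norm_opTensor_le (f : K →L[ℂ] K) (g : L →L[ℂ] L) : ‖opTensor f g‖ ≤ ‖f‖ * ‖g‖ := by
  refine ContinuousLinearMap.opNorm_le_bound _ (by positivity) fun x => ?_
  refine denseRange_toHilbertTensor.induction_on (p := fun x =>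
    ‖opTensor f g x‖ ≤ ‖f‖ * ‖g‖ * ‖x‖) x (isClosed_le (by fun_prop) (by fun_prop)) fun a => ?_
  rw [opTensor_coe, LinearIsometry.norm_map, LinearIsometry.norm_map]
  exact ContinuousLinearMap.le_of_opNorm_le _ (TensorProduct.norm_mapL_le f g) a

end HilbertTensor

section MinTensor

variable (A : Type u) (B : Type v) [NonUnitalCStarAlgebra A] [NonUnitalCStarAlgebra B]

/-- The algebraic tensor product `A ⊗ B` of two C*-algebras, to be normed by the minimal norm. -/
def AlgMinTensor : Type (max u v) := A ⊗[ℂ] B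

instance : AddCommGroup (AlgMinTensor A B) := inferInstanceAs (AddCommGroup (A ⊗[ℂ] B))

instance : Module ℂ (AlgMinTensor A B) := inferInstanceAs (Module ℂ (A ⊗[ℂ] B))

variable {A B}

/-- The elementary tensor `a ⊗ b` in the algebraic tensor product. -/
def AlgMinTensor.tmul (a : A) (b : B) : AlgMinTensor A B := (a ⊗ₜ[ℂ] b : A ⊗[ℂ] B)

/-- For representations `π₁`, `π₂` of `A`, `B` on Hilbert spaces `K`, `L`, the linear map `π₁ ⊗ π₂`
from `A ⊗ B` to the bounded operators on the Hilbert space tensor product of `K` and `L`, given by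
`a ⊗ b ↦ π₁ a ⊗ π₂ b`. -/
def repTensor {K : Type w} {L : Type z}
    [NormedAddCommGroup K] [InnerProductSpace ℂ K] [CompleteSpace K]
    [NormedAddCommGroup L] [InnerProductSpace ℂ L] [CompleteSpace L]
    (π₁ : A →⋆ₙₐ[ℂ] (K →L[ℂ] K)) (π₂ : B →⋆ₙₐ[ℂ] (L →L[ℂ] L)) :
    AlgMinTensor A B →ₗ[ℂ] (HilbertTensor K L →L[ℂ] HilbertTensor K L) :=
  TensorProduct.lift <| LinearMap.mk₂ ℂ (fun a b => opTensor (π₁ a) (π₂ b))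
    (fun a a' b => opTensor_ext fun x => by
      simp only [map_add, add_apply, opTensor_coe, TensorProduct.mapL_add_left])
    (fun c a b => opTensor_ext fun x => by
      simp only [map_smul, smul_apply, opTensor_coe, TensorProduct.mapL_smul_left])
    (fun a b b' => opTensor_ext fun x => by
      simp only [map_add, add_apply, opTensor_coe, TensorProduct.mapL_add_right])
    (fun c a b => opTensor_ext fun x => by
      simp only [map_smul, smul_apply, opTensor_coe, TensorProduct.mapL_smul_right])

theorem repTensor_tmul {K : Type w} {L : Type z}
    [NormedAddCommGroup K] [InnerProductSpace ℂ K] [CompleteSpace K]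
    [NormedAddCommGroup L] [InnerProductSpace ℂ L] [CompleteSpace L]
    (π₁ : A →⋆ₙₐ[ℂ] (K →L[ℂ] K)) (π₂ : B →⋆ₙₐ[ℂ] (L →L[ℂ] L)) (a : A) (b : B) :
    repTensor π₁ π₂ (AlgMinTensor.tmul a b) = opTensor (π₁ a) (π₂ b) := rfl

/-- The values `‖(π₁ ⊗ π₂) u‖`, over all representations `π₁` of `A` and `π₂` of `B` on Hilbert
spaces. (Spaces in the universes of `A` and `B` suffice: they contain all cyclic
representations up to unitary equivalence.) -/
def minNormSet (u : AlgMinTensor A B) : Set ℝ :=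
  {r | ∃ (K : Type u) (L : Type v)
      (_ : NormedAddCommGroup K) (_ : InnerProductSpace ℂ K) (_ : CompleteSpace K)
      (_ : NormedAddCommGroup L) (_ : InnerProductSpace ℂ L) (_ : CompleteSpace L)
      (π₁ : A →⋆ₙₐ[ℂ] (K →L[ℂ] K)) (π₂ : B →⋆ₙₐ[ℂ] (L →L[ℂ] L)),
      r = ‖repTensor π₁ π₂ u‖}

theorem minNormSet_bddAbove (u : AlgMinTensor A B) : BddAbove (minNormSet u) := by
  suffices h : ∃ C : ℝ, ∀ r ∈ minNormSet u, r ≤ C from h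
  induction u using TensorProduct.induction_on with
  | zero =>
    refine ⟨0, ?_⟩
    rintro r ⟨K, L, _, _, _, _, _, _, π₁, π₂, rfl⟩
    exact (congrArg norm (map_zero (repTensor π₁ π₂))).le.trans norm_zero.le
  | tmul a b =>
    refine ⟨‖a‖ * ‖b‖, ?_⟩
    rintro r ⟨K, L, _, _, _, _, _, _, π₁, π₂, rfl⟩
    refine (congrArg norm (repTensor_tmul π₁ π₂ a b)).le.trans ?_
    refine (norm_opTensor_le _ _).trans ?_
    exact mul_le_mul (NonUnitalStarAlgHom.norm_apply_le π₁ a)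
      (NonUnitalStarAlgHom.norm_apply_le π₂ b) (norm_nonneg _) (norm_nonneg _)
  | add x y hx hy =>
    obtain ⟨C, hC⟩ := hx
    obtain ⟨D, hD⟩ := hy
    refine ⟨C + D, ?_⟩
    rintro r ⟨K, L, _, _, _, _, _, _, π₁, π₂, rfl⟩
    refine (congrArg norm (map_add (repTensor π₁ π₂) x y)).le.trans ((norm_add_le _ _).trans ?_)
    exact add_le_add (hC _ ⟨K, L, _, _, _, _, _, _, π₁, π₂, rfl⟩)
      (hD _ ⟨K, L, _, _, _, _, _, _, π₁, π₂, rfl⟩)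

/-- The minimal C*-tensor norm on `A ⊗ B`:
the supremum of `‖(π₁ ⊗ π₂) u‖` over all representations. -/
def minNorm (u : AlgMinTensor A B) : ℝ := sSup (minNormSet u)

theorem le_minNorm (u : AlgMinTensor A B) {r : ℝ} (hr : r ∈ minNormSet u) : r ≤ minNorm u :=
  le_csSup (minNormSet_bddAbove u) hr

theorem minNormSet_nonempty (u : AlgMinTensor A B) : (minNormSet u).Nonempty :=
  ⟨_, PUnit, PUnit, inferInstance, inferInstance, inferInstance,
    inferInstance, inferInstance, inferInstance, 0, 0, rfl⟩

theorem minNorm_le (u : AlgMinTensor A B) {C : ℝ} (h : ∀ r ∈ minNormSet u, r ≤ C) :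
    minNorm u ≤ C :=
  csSup_le (minNormSet_nonempty u) h

theorem minNorm_zero : minNorm (0 : AlgMinTensor A B) = 0 := by
  have h : ∀ r ∈ minNormSet (0 : AlgMinTensor A B), r = 0 := by
    rintro r ⟨K, L, _, _, _, _, _, _, π₁, π₂, rfl⟩
    rw [map_zero, norm_zero]
  obtain ⟨r, hr⟩ := minNormSet_nonempty (0 : AlgMinTensor A B)
  exact le_antisymm (minNorm_le _ fun r hr => (h r hr).le) ((h r hr).ge.trans (le_minNorm _ hr))

theorem minNorm_add_le (x y : AlgMinTensor A B) : minNorm (x + y) ≤ minNorm x + minNorm y := by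
  refine minNorm_le _ ?_
  rintro r ⟨K, L, _, _, _, _, _, _, π₁, π₂, rfl⟩
  rw [map_add]
  exact (norm_add_le _ _).trans (add_le_add
    (le_minNorm _ ⟨K, L, _, _, _, _, _, _, π₁, π₂, rfl⟩)
    (le_minNorm _ ⟨K, L, _, _, _, _, _, _, π₁, π₂, rfl⟩))

theorem minNorm_smul_le (c : ℂ) (x : AlgMinTensor A B) : minNorm (c • x) ≤ ‖c‖ * minNorm x := by
  refine minNorm_le _ ?_
  rintro r ⟨K, L, _, _, _, _, _, _, π₁, π₂, rfl⟩
  rw [map_smul, norm_smul]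
  exact mul_le_mul_of_nonneg_left
    (le_minNorm _ ⟨K, L, _, _, _, _, _, _, π₁, π₂, rfl⟩) (norm_nonneg _)

theorem minNorm_neg (x : AlgMinTensor A B) : minNorm (-x) = minNorm x := by
  have h : ∀ y : AlgMinTensor A B, minNorm (-y) ≤ minNorm y := fun y => by
    simpa using minNorm_smul_le (-1 : ℂ) y
  exact le_antisymm (h x) (by simpa using h (-x))

instance : SeminormedAddCommGroup (AlgMinTensor A B) :=
  AddGroupSeminorm.toSeminormedAddCommGroup
    { toFun := minNorm
      map_zero' := minNorm_zero
      add_le' := minNorm_add_le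
      neg' := minNorm_neg }

instance : NormedSpace ℂ (AlgMinTensor A B) where
  norm_smul_le := minNorm_smul_le

theorem AlgMinTensor.norm_def (x : AlgMinTensor A B) : ‖x‖ = minNorm x := rfl

variable (A B)

/-- The minimal C*-tensor product of `A` and `B`: the completion of `A ⊗ B` in the minimal norm. -/
abbrev MinTensor : Type (max u v) := UniformSpace.Completion (AlgMinTensor A B)

variable {A B}

/-- The elementary tensor `a ⊗ b` as an element of the minimal tensor product. -/
def minTmul (a : A) (b : B) : MinTensor A B :=
  UniformSpace.Completion.toComplₗᵢ (𝕜 := ℂ) (AlgMinTensor.tmul a b)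

end MinTensor

end

/-!
A rank one operator has the form `T = ⟪y, ·⟫ x`, so for every bounded `S`
`T T⋆ T = ‖T‖² T` and `T⋆ S T⋆ T = c T⋆ T`, where `c = ⟪x, S y⟫`.
The scalar `c` decides orthogonality. If `c = 0`, the C⋆-identity gives `T ⟂ S`
(`bjOrthogonal_of_star_mul_mul_eq_zero`).

Suppose therefore that `c₁` and `c₂` are both nonzero. The two relations are algebraic, so they
pass to `W = π₁ T₁ ⊗ π₂ T₂` and `V = π₁ S₁ ⊗ π₂ S₂` for any representations `π₁`, `π₂`, with
`N = ‖T₁‖ ‖T₂‖` and `c = c₁ c₂ ≠ 0`. Thus `W` is `N` times a partial isometry, and `W⋆ V` acts as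
the scalar `c` on its initial space. Adding `α V` with `α = -t c̄` and small `t > 0` shortens
the image of the initial space to first order in `t`, while the cross term with the kernel of `W`
costs only `O(t²)`. Hence `‖W + α V‖ ≤ r` with `r < N` (`norm_add_smul_le_of_corner`), where `α`
and `r` depend on `N`, `c` and `‖S₁‖ ‖S₂‖` but not on the representations. So the minimal norm of
`T₁ ⊗ T₂ + α S₁ ⊗ S₂` is below `N`, which is the norm of `T₁ ⊗ T₂`, and
`T₁ ⊗ T₂` is not orthogonal to `S₁ ⊗ S₂`.
-/

open ContinuousLinearMap InnerProductSpace

/-! ### Rank one operators -/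

section RankOne

variable {H : Type*} [NormedAddCommGroup H] [InnerProductSpace ℂ H] [CompleteSpace H]

theorem IsRankOneOp.exists_eq_rankOne {T : H →L[ℂ] H} (hT : IsRankOneOp T) :
    ∃ x y : H, T = rankOne ℂ x y := by
  obtain ⟨⟨v, hv⟩, hv0, hspan⟩ := finrank_eq_one_iff'.1 hT
  have hv0 : v ≠ 0 := fun h => hv0 (Subtype.ext h)
  refine ⟨v, ((‖v‖ ^ 2 : ℝ) : ℂ)⁻¹ • star T v, ?_⟩
  ext z
  obtain ⟨c, hc⟩ := hspan ⟨T z, z, rfl⟩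
  have hc : c • v = T z := congrArg Subtype.val hc
  have hn : ((‖v‖ : ℝ) : ℂ) ≠ 0 := by simpa using hv0
  rw [rankOne_apply, inner_smul_left, star_eq_adjoint, adjoint_inner_left, ← hc, inner_smul_right,
    inner_self_eq_norm_sq_to_K]
  congr 1
  simp
  field_simp

theorem rankOne_mul_star_mul_self (x y : H) :
    rankOne ℂ x y * (star (rankOne ℂ x y) * rankOne ℂ x y)
      = ((‖rankOne ℂ x y‖ ^ 2 : ℝ) : ℂ) • rankOne ℂ x y := by
  ext z
  simp only [star_eq_adjoint, adjoint_rankOne, mul_apply_eq_comp, rankOne_apply,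
    inner_smul_right, inner_self_eq_norm_sq_to_K, smul_apply, norm_rankOne, smul_smul]
  congr 1
  push_cast
  simp only [Complex.coe_algebraMap]
  ring

theorem star_rankOne_mul_mul (x y : H) (S : H →L[ℂ] H) :
    star (rankOne ℂ x y) * S * (star (rankOne ℂ x y) * rankOne ℂ x y)
      = inner ℂ x (S y) • (star (rankOne ℂ x y) * rankOne ℂ x y) := by
  ext z
  simp only [star_eq_adjoint, adjoint_rankOne, mul_apply_eq_comp, rankOne_apply,
    map_smul, smul_apply, smul_smul]
  congr 1
  ring

end RankOne

/-- If `T⋆ S T⋆ T` vanishes, then `T⋆ (T + α S) T⋆ T = (T⋆ T)²`, whose norm is `‖T‖ ^ 4` by the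
C⋆-identity. -/
theorem bjOrthogonal_of_star_mul_mul_eq_zero {A : Type*} [NonUnitalCStarAlgebra A] {T S : A}
    (h : star T * S * (star T * T) = 0) : BJOrthogonal ℂ T S := by
  intro α
  rcases (norm_nonneg T).eq_or_lt with h0 | h0
  · rw [← h0]; positivity
  have key : star (star T * T) * (star T * T) = star T * (T + α • S) * (star T * T) := by
    rw [mul_add, add_mul, mul_smul_comm, smul_mul_assoc, h, smul_zero, add_zero, star_mul,
      star_star]
  have hle : (‖T‖ * ‖T‖) * (‖T‖ * ‖T‖) ≤ ‖T‖ * ‖T + α • S‖ * (‖T‖ * ‖T‖) := by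
    have := congrArg norm key
    rw [CStarRing.norm_star_mul_self, CStarRing.norm_star_mul_self] at this
    rw [this]
    refine (norm_mul_le _ _).trans ?_
    rw [CStarRing.norm_star_mul_self]
    gcongr
    exact (norm_mul_le _ _).trans_eq (by rw [norm_star])
  exact le_of_mul_le_mul_left (le_of_mul_le_mul_right hle (by positivity)) h0

/-! ### Algebra of tensor products of operators -/

section OpTensor

variable {K L : Type*}
  [NormedAddCommGroup K] [InnerProductSpace ℂ K] [NormedAddCommGroup L] [InnerProductSpace ℂ L]

theorem opTensor_mul (f f' : K →L[ℂ] K) (g g' : L →L[ℂ] L) :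
    opTensor (f * f') (g * g') = opTensor f g * opTensor f' g' := by
  refine opTensor_ext fun x => ?_
  rw [mul_apply_eq_comp, opTensor_coe, opTensor_coe, opTensor_coe,
    TensorProduct.mapL_mul]
  rfl

theorem opTensor_smul_smul (c d : ℂ) (f : K →L[ℂ] K) (g : L →L[ℂ] L) :
    opTensor (c • f) (d • g) = (c * d) • opTensor f g := by
  refine opTensor_ext fun x => ?_
  simp only [smul_apply, opTensor_coe, TensorProduct.mapL_smul_left,
    TensorProduct.mapL_smul_right, map_smul, smul_smul, mul_comm]

theorem inner_mapL_left [CompleteSpace K] [CompleteSpace L] (f : K →L[ℂ] K) (g : L →L[ℂ] L)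
    (x y : TensorProduct ℂ K L) :
    inner ℂ (TensorProduct.mapL (star f) (star g) x) y
      = inner ℂ x (TensorProduct.mapL f g y) := by
  induction x using TensorProduct.induction_on with
  | zero => simp
  | add x₁ x₂ h₁ h₂ => rw [map_add, inner_add_left, inner_add_left, h₁, h₂]
  | tmul a b =>
    induction y using TensorProduct.induction_on with
    | zero => simp
    | add y₁ y₂ h₁ h₂ => rw [map_add, inner_add_right, inner_add_right, h₁, h₂]
    | tmul a' b' =>
      rw [TensorProduct.mapL_tmul, TensorProduct.mapL_tmul, TensorProduct.inner_tmul,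
        TensorProduct.inner_tmul, star_eq_adjoint, star_eq_adjoint, adjoint_inner_left,
        adjoint_inner_left]

theorem star_opTensor [CompleteSpace K] [CompleteSpace L] (f : K →L[ℂ] K) (g : L →L[ℂ] L) :
    star (opTensor f g) = opTensor (star f) (star g) := by
  symm
  rw [star_eq_adjoint (opTensor f g), eq_adjoint_iff]
  intro x y
  refine denseRange_toHilbertTensor.induction_on₂ (p := fun x y =>
    inner ℂ (opTensor (star f) (star g) x) y = inner ℂ x (opTensor f g y))
    (isClosed_eq (by fun_prop) (by fun_prop)) (fun a b => ?_) x y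
  rw [opTensor_coe, opTensor_coe, LinearIsometry.inner_map_map, LinearIsometry.inner_map_map,
    inner_mapL_left]

theorem mul_norm_le_norm_opTensor_mul (f : K →L[ℂ] K) (g : L →L[ℂ] L) (x : K) (y : L) :
    ‖f x‖ * ‖g y‖ ≤ ‖opTensor f g‖ * (‖x‖ * ‖y‖) := by
  have := (opTensor f g).le_opNorm (toHilbertTensor (x ⊗ₜ[ℂ] y))
  rwa [opTensor_coe, LinearIsometry.norm_map, LinearIsometry.norm_map, TensorProduct.mapL_tmul,
    TensorProduct.norm_tmul, TensorProduct.norm_tmul] at this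

end OpTensor

/-! ### Decreasing the norm by a small perturbation -/

/-- The coefficients of `a ^ 2` and `b ^ 2` in the quadratic form on the left fall below `N ^ 2`
for small `t`, the mixed term being absorbed up to an error quadratic in `t`. -/
theorem exists_quadratic_form_lt {N k M : ℝ} (hN : 0 < N) (hk : 0 < k) (hM : 0 ≤ M) :
    ∃ t r : ℝ, 0 ≤ t ∧ 0 ≤ r ∧ r < N ∧ ∀ a b : ℝ,
      N ^ 2 * a ^ 2 - 2 * (t * k ^ 2) * a ^ 2 + 2 * (t * k * M * N) * (a * b)
        + t ^ 2 * k ^ 2 * M ^ 2 * (a ^ 2 + b ^ 2) ≤ r ^ 2 * (a ^ 2 + b ^ 2) := by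
  obtain ⟨t, ht0, ht1, ht2⟩ : ∃ t : ℝ, 0 < t ∧ 3 * t * M ^ 2 ≤ 1 ∧ 2 * (t * k * M) ≤ N := by
    refine ⟨min (1 / (3 * (M ^ 2 + 1))) (N / (2 * (k * M + 1))), by positivity, ?_, ?_⟩
    · have h := min_le_left (1 / (3 * (M ^ 2 + 1))) (N / (2 * (k * M + 1)))
      rw [le_div_iff₀ (by positivity)] at h
      have : 0 < min (1 / (3 * (M ^ 2 + 1))) (N / (2 * (k * M + 1))) := by positivity
      linarith
    · have h := min_le_right (1 / (3 * (M ^ 2 + 1))) (N / (2 * (k * M + 1)))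
      rw [le_div_iff₀ (by positivity)] at h
      have : 0 < min (1 / (3 * (M ^ 2 + 1))) (N / (2 * (k * M + 1))) := by positivity
      linarith
  have hm0 : 0 ≤ max (N ^ 2 - t * k ^ 2) (3 / 4 * N ^ 2) :=
    (by positivity : (0 : ℝ) ≤ 3 / 4 * N ^ 2).trans (le_max_right _ _)
  refine ⟨t, √(max (N ^ 2 - t * k ^ 2) (3 / 4 * N ^ 2)), ht0.le, Real.sqrt_nonneg _, ?_,
    fun a b => ?_⟩
  · rw [Real.sqrt_lt' hN]
    refine max_lt ?_ ?_
    · have : 0 < t * k ^ 2 := by positivity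
      linarith
    · have : 0 < N ^ 2 := by positivity
      linarith
  · rw [Real.sq_sqrt hm0]
    have h1 := mul_le_mul_of_nonneg_right (le_max_left (N ^ 2 - t * k ^ 2) (3 / 4 * N ^ 2))
      (sq_nonneg a)
    have h2 := mul_le_mul_of_nonneg_right (le_max_right (N ^ 2 - t * k ^ 2) (3 / 4 * N ^ 2))
      (sq_nonneg b)
    have h3 : 4 * (t * k * M) ^ 2 ≤ N ^ 2 := by
      have := pow_le_pow_left₀ (by positivity) ht2 2
      linarith
    have h4 := mul_le_mul_of_nonneg_right h3 (sq_nonneg b)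
    have h5 := mul_le_mul_of_nonneg_right ht1 (by positivity : 0 ≤ t * k ^ 2 * a ^ 2)
    -- the mixed term is at most `2 (t k M a) ^ 2 + (N b) ^ 2 / 2`
    have h6 := sq_nonneg (2 * (t * k * M) * a - N * b)
    linarith

/-- If `W` is a multiple of a partial isometry and `c` is the scalar by which `W⋆ V` acts on its
initial space, then `α = -t c̄` gives `‖W + α V‖ < ‖W‖` to first order in `t`; the quadratic form
controls the error in terms of `‖V‖` only. -/
theorem norm_add_smul_le_of_corner {G : Type*} [NormedAddCommGroup G] [InnerProductSpace ℂ G]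
    [CompleteSpace G] {W V : G →L[ℂ] G} {N M t r : ℝ} {c : ℂ} (hN : 0 < N)
    (hW : W * (star W * W) = ((N ^ 2 : ℝ) : ℂ) • W)
    (hV : star W * V * (star W * W) = c • (star W * W)) (hM : ‖V‖ ≤ M) (ht : 0 ≤ t) (hr : 0 ≤ r)
    (hq : ∀ a b : ℝ,
      N ^ 2 * a ^ 2 - 2 * (t * ‖c‖ ^ 2) * a ^ 2 + 2 * (t * ‖c‖ * M * N) * (a * b)
        + t ^ 2 * ‖c‖ ^ 2 * M ^ 2 * (a ^ 2 + b ^ 2) ≤ r ^ 2 * (a ^ 2 + b ^ 2)) :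
    ‖W + (-(t : ℂ) * star c) • V‖ ≤ r := by
  refine opNorm_le_bound _ hr fun z => ?_
  have hN0 : ((N ^ 2 : ℝ) : ℂ) ≠ 0 := by exact_mod_cast (by positivity : N ^ 2 ≠ 0)
  -- `p` is the component of `z` in the initial space of `W`, and `q` the one in the kernel
  set p : G := ((N ^ 2 : ℝ) : ℂ)⁻¹ • (star W * W) z with hp
  obtain ⟨q, hz⟩ : ∃ q, z = p + q := ⟨z - p, by abel⟩
  have hWWz : (star W * W) z = ((N ^ 2 : ℝ) : ℂ) • p := by rw [hp, smul_inv_smul₀ hN0]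
  have hWp : W p = W z := by
    have := DFunLike.congr_fun hW z
    rw [mul_apply_eq_comp, smul_apply, hWWz, map_smul] at this
    exact smul_right_injective _ hN0 this
  have hWq : W q = 0 := by
    have : W z = W p + W q := by rw [← map_add, ← hz]
    rw [hWp] at this
    simpa using this
  have hWV : star W (V p) = c • p := by
    have := DFunLike.congr_fun hV z
    rw [mul_apply_eq_comp, smul_apply, hWWz, map_smul, smul_comm] at this
    exact smul_right_injective _ hN0 this
  have hpq : inner ℂ p q = 0 := by
    rw [hp, inner_smul_left, mul_apply_eq_comp, star_eq_adjoint, adjoint_inner_left,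
      hWq, inner_zero_right, mul_zero]
  have hzn : ‖z‖ ^ 2 = ‖p‖ ^ 2 + ‖q‖ ^ 2 := by
    rw [hz, sq, sq, sq]
    exact norm_add_sq_eq_norm_sq_add_norm_sq_of_inner_eq_zero p q hpq
  have hWn : ‖W p‖ ^ 2 = N ^ 2 * ‖p‖ ^ 2 := by
    have h1 : inner ℂ (W p) (W p) = ((N ^ 2 * ‖p‖ ^ 2 : ℝ) : ℂ) := by
      rw [← adjoint_inner_right, hWp, ← star_eq_adjoint,
        show star W (W z) = ((N ^ 2 : ℝ) : ℂ) • p from hWWz,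
        inner_smul_right, inner_self_eq_norm_sq_to_K]
      push_cast
      rfl
    exact (inner_self_eq_norm_sq (𝕜 := ℂ) (W p)).symm.trans
      ((congrArg Complex.re h1).trans (Complex.ofReal_re _))
  have hWn' : ‖W p‖ = N * ‖p‖ := by
    rw [← mul_pow] at hWn
    exact (sq_eq_sq₀ (norm_nonneg _) (by positivity)).1 hWn
  have hM0 : 0 ≤ M := (norm_nonneg _).trans hM
  set α : ℂ := -(t : ℂ) * star c with hα
  have hαn : ‖α‖ = t * ‖c‖ := by simp [hα, abs_of_nonneg ht]
  have hi1 : RCLike.re (inner ℂ (W p) (α • V p)) = -(t * ‖c‖ ^ 2 * ‖p‖ ^ 2) := by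
    rw [inner_smul_right, ← adjoint_inner_right, ← star_eq_adjoint, hWV, inner_smul_right,
      inner_self_eq_norm_sq_to_K]
    have : α * (c * ((‖p‖ : ℝ) : ℂ) ^ 2) = ((-(t * ‖c‖ ^ 2 * ‖p‖ ^ 2) : ℝ) : ℂ) := by
      have hc : star c * c = ((‖c‖ ^ 2 : ℝ) : ℂ) := by
        push_cast
        exact Complex.conj_mul' c
      rw [hα]
      linear_combination (norm := (push_cast; ring)) (-(t : ℂ) * ((‖p‖ : ℝ) : ℂ) ^ 2) * hc
    exact (congrArg Complex.re this).trans (Complex.ofReal_re _)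
  have hi2 : RCLike.re (inner ℂ (W p) (α • V q)) ≤ t * ‖c‖ * M * N * (‖p‖ * ‖q‖) := by
    refine (RCLike.re_le_norm _).trans ((norm_inner_le_norm _ _).trans ?_)
    rw [norm_smul, hαn, hWn']
    have := V.le_of_opNorm_le hM q
    calc N * ‖p‖ * (t * ‖c‖ * ‖V q‖) ≤ N * ‖p‖ * (t * ‖c‖ * (M * ‖q‖)) := by gcongr
      _ = _ := by ring
  have hVz : ‖α • V z‖ ^ 2 ≤ t ^ 2 * ‖c‖ ^ 2 * M ^ 2 * (‖p‖ ^ 2 + ‖q‖ ^ 2) := by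
    rw [norm_smul, hαn, ← hzn]
    have := V.le_of_opNorm_le hM z
    calc (t * ‖c‖ * ‖V z‖) ^ 2 ≤ (t * ‖c‖ * (M * ‖z‖)) ^ 2 := by gcongr
      _ = _ := by ring
  have hsq : ‖(W + α • V) z‖ ^ 2 ≤ (r * ‖z‖) ^ 2 := by
    have hVadd : α • V z = α • V p + α • V q := by rw [← smul_add, ← map_add, ← hz]
    rw [add_apply, smul_apply, ← hWp, norm_add_sq (𝕜 := ℂ), hWn, mul_pow, hzn]
    have : RCLike.re (inner ℂ (W p) (α • V z)) = -(t * ‖c‖ ^ 2 * ‖p‖ ^ 2)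
        + RCLike.re (inner ℂ (W p) (α • V q)) := by
      rw [hVadd, inner_add_right, map_add, hi1]
    rw [this]
    linarith [hq ‖p‖ ‖q‖]
  exact (sq_le_sq₀ (norm_nonneg _) (by positivity)).1 hsq

/-! ### The minimal tensor norm -/

section MinTensor

variable {A B : Type*} [NonUnitalCStarAlgebra A] [NonUnitalCStarAlgebra B]

theorem norm_minTmul_add_smul (a a' : A) (b b' : B) (α : ℂ) :
    ‖(minTmul a b + α • minTmul a' b' : MinTensor A B)‖
      = minNorm (AlgMinTensor.tmul a b + α • AlgMinTensor.tmul a' b') := by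
  rw [minTmul, minTmul, ← map_smul, ← map_add, LinearIsometry.norm_map, AlgMinTensor.norm_def]

theorem norm_minTmul (a : A) (b : B) :
    ‖(minTmul a b : MinTensor A B)‖ = minNorm (AlgMinTensor.tmul a b) := by
  rw [minTmul, LinearIsometry.norm_map, AlgMinTensor.norm_def]

/-- Every representation preserves the two relations of `norm_add_smul_le_of_corner`, and the bound
obtained there does not depend on the representation. -/
theorem minNorm_add_smul_lt_of_corner {T₁ S₁ : A} {T₂ S₂ : B} {N₁ N₂ : ℝ} {c₁ c₂ : ℂ}
    (hN₁ : 0 < N₁) (hN₂ : 0 < N₂) (hc₁ : c₁ ≠ 0) (hc₂ : c₂ ≠ 0)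
    (hT₁ : T₁ * (star T₁ * T₁) = ((N₁ ^ 2 : ℝ) : ℂ) • T₁)
    (hT₂ : T₂ * (star T₂ * T₂) = ((N₂ ^ 2 : ℝ) : ℂ) • T₂)
    (hS₁ : star T₁ * S₁ * (star T₁ * T₁) = c₁ • (star T₁ * T₁))
    (hS₂ : star T₂ * S₂ * (star T₂ * T₂) = c₂ • (star T₂ * T₂)) :
    ∃ α : ℂ, minNorm (AlgMinTensor.tmul T₁ T₂ + α • AlgMinTensor.tmul S₁ S₂) < N₁ * N₂ := by
  obtain ⟨t, r, ht, hr, hrN, hq⟩ := exists_quadratic_form_lt (M := ‖S₁‖ * ‖S₂‖)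
    (mul_pos hN₁ hN₂) (norm_pos_iff.2 (mul_ne_zero hc₁ hc₂)) (by positivity)
  refine ⟨-(t : ℂ) * star (c₁ * c₂), (minNorm_le _ ?_).trans_lt hrN⟩
  rintro _ ⟨K, L, _, _, _, _, _, _, π₁, π₂, rfl⟩
  rw [map_add, map_smul, repTensor_tmul, repTensor_tmul]
  refine norm_add_smul_le_of_corner (mul_pos hN₁ hN₂) ?_ ?_ ?_ ht hr hq
  · rw [star_opTensor, ← opTensor_mul, ← opTensor_mul, ← map_star, ← map_star, ← map_mul,
      ← map_mul, ← map_mul, ← map_mul, hT₁, hT₂, map_smul, map_smul, opTensor_smul_smul]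
    congr 1
    push_cast
    ring
  · rw [star_opTensor, ← opTensor_mul, ← opTensor_mul, ← opTensor_mul, ← map_star, ← map_star,
      ← map_mul, ← map_mul, ← map_mul, ← map_mul, ← map_mul, ← map_mul, hS₁, hS₂, map_smul,
      map_smul, opTensor_smul_smul]
  · refine (norm_opTensor_le _ _).trans ?_
    gcongr
    · exact NonUnitalStarAlgHom.norm_apply_le π₁ S₁
    · exact NonUnitalStarAlgHom.norm_apply_le π₂ S₂

end MinTensor

/-- The identity representations already attain the product of the norms at rank one operators. -/
theorem norm_mul_norm_le_minNorm_rankOne {H : Type*} [NormedAddCommGroup H]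
    [InnerProductSpace ℂ H] [CompleteSpace H] (x₁ y₁ x₂ y₂ : H) :
    ‖rankOne ℂ x₁ y₁‖ * ‖rankOne ℂ x₂ y₂‖
      ≤ minNorm (AlgMinTensor.tmul (rankOne ℂ x₁ y₁) (rankOne ℂ x₂ y₂)) := by
  refine le_trans ?_ (le_minNorm _ ⟨H, H, inferInstance, inferInstance, inferInstance,
    inferInstance, inferInstance, inferInstance, NonUnitalStarAlgHom.id ℂ _,
    NonUnitalStarAlgHom.id ℂ _, rfl⟩)
  rw [repTensor_tmul]
  have h := mul_norm_le_norm_opTensor_mul (rankOne ℂ x₁ y₁) (rankOne ℂ x₂ y₂) y₁ y₂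
  rw [rankOne_apply, rankOne_apply, norm_smul, norm_smul, inner_self_eq_norm_sq_to_K,
    inner_self_eq_norm_sq_to_K] at h
  rw [norm_rankOne, norm_rankOne]
  rcases eq_or_ne y₁ 0 with rfl | h₁
  · simp
  rcases eq_or_ne y₂ 0 with rfl | h₂
  · simp
  have : 0 < ‖y₁‖ * ‖y₂‖ := by positivity
  refine le_of_mul_le_mul_right (le_trans (le_of_eq ?_) h) this
  simp
  ring

theorem mainTheorem5 {H : Type*} [NormedAddCommGroup H] [InnerProductSpace ℂ H] [CompleteSpace H]
    (T₁ T₂ S₁ S₂ : H →L[ℂ] H)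
    (hT₁ : IsRankOneOp T₁) (hT₂ : IsRankOneOp T₂)
    (hS₁ : IsRankOneOp S₁) (hS₂ : IsRankOneOp S₂)
    (h : BJOrthogonal ℂ (minTmul T₁ T₂ : MinTensor (H →L[ℂ] H) (H →L[ℂ] H)) (minTmul S₁ S₂)) :
    BJOrthogonal ℂ T₁ S₁ ∨ BJOrthogonal ℂ T₂ S₂ := by
  obtain ⟨x₁, y₁, rfl⟩ := hT₁.exists_eq_rankOne
  obtain ⟨x₂, y₂, rfl⟩ := hT₂.exists_eq_rankOne
  have hS₁' := star_rankOne_mul_mul x₁ y₁ S₁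
  have hS₂' := star_rankOne_mul_mul x₂ y₂ S₂
  by_cases hc₁ : inner ℂ x₁ (S₁ y₁) = 0
  · exact .inl (bjOrthogonal_of_star_mul_mul_eq_zero (by rw [hS₁', hc₁, zero_smul]))
  by_cases hc₂ : inner ℂ x₂ (S₂ y₂) = 0
  · exact .inr (bjOrthogonal_of_star_mul_mul_eq_zero (by rw [hS₂', hc₂, zero_smul]))
  have hpos : ∀ {x y : H} {S : H →L[ℂ] H}, inner ℂ x (S y) ≠ 0 → 0 < ‖rankOne ℂ x y‖ := by
    intro x y S hc
    refine norm_pos_iff.2 (rankOne_ne_zero ?_ ?_) <;> rintro rfl <;> simp at hc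
  obtain ⟨α, hα⟩ := minNorm_add_smul_lt_of_corner (hpos hc₁) (hpos hc₂) hc₁ hc₂
    (rankOne_mul_star_mul_self x₁ y₁) (rankOne_mul_star_mul_self x₂ y₂) hS₁' hS₂'
  have hle := h α
  rw [norm_minTmul_add_smul, norm_minTmul] at hle
  exact absurd ((norm_mul_norm_le_minNorm_rankOne x₁ y₁ x₂ y₂).trans hle) hα.not_ge
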